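/- For a partition $\pi$ of a positive integer, let $s(\pi)$ and $l(\pi)$ denote its smallest and largest part, $\#(\pi)$ its number of parts, and $\nu_d(\pi)$ its number of parts counted without multiplicity (that is, the number of different part sizes). Let $\mathcal{P}(n)$ be the set of all partitions of $n$ and $\mathcal{D}(n)$ the set of partitions of $n$ into distinct parts. Let $n\ge 1$ be an integer and let $z,c$ be complex numbers with $c\neq 0$. Then $$\sum_{\pi\in\mathcal{D}(n)}(-1)^{\#(\pi)-1}\,z^{\,l(\pi)+1-s(\pi)}\,c^{\,s(\pi)-1}\,\frac{\left(\frac zc\right)^{s(\pi)}-1}{\frac zc-1}\;=\;\sum_{\pi\in\mathcal{P}(n)}z^{\#(\pi)}\,c^{\,l(\pi)-1}\left(1-\frac1c\right)^{\nu_d(\pi)-1},$$ where for $z=c$ the quotient on the left is read as its limiting value $s(\pi)$, and where $0^0=1$. -/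

import Mathlib

namespace PartitionStat

/-- The smallest part `s(π)` (a genuine minimum for `n ≠ 0`, see `isLeast_smallestPart`). -/
noncomputable def smallestPart {n : ℕ} (π : n.Partition) : ℕ := sInf {i : ℕ | i ∈ π.parts}

/-- The largest part `l(π)` (a genuine maximum for `n ≠ 0`, see `isGreatest_largestPart`). -/
def largestPart {n : ℕ} (π : n.Partition) : ℕ := π.parts.sup

/-- The number of parts `#(π)`, counted with multiplicity. -/
def numParts {n : ℕ} (π : n.Partition) : ℕ := Multiset.card π.parts

/-- The number `ν_d(π)` of parts counted without multiplicity, i.e. of different part sizes. -/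
def numDistinctParts {n : ℕ} (π : n.Partition) : ℕ := π.parts.toFinset.card

theorem exists_mem_parts {n : ℕ} (hn : n ≠ 0) (π : n.Partition) : ∃ i, i ∈ π.parts := by
  apply Multiset.exists_mem_of_ne_zero
  intro h
  have hs := π.parts_sum
  rw [h, Multiset.sum_zero] at hs
  exact hn hs.symm

theorem isLeast_smallestPart {n : ℕ} (hn : n ≠ 0) (π : n.Partition) :
    IsLeast {i : ℕ | i ∈ π.parts} (smallestPart π) :=
  ⟨Nat.sInf_mem (exists_mem_parts hn π), fun _ hi => Nat.sInf_le hi⟩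

theorem isGreatest_largestPart {n : ℕ} (hn : n ≠ 0) (π : n.Partition) :
    IsGreatest {i : ℕ | i ∈ π.parts} (largestPart π) := by
  have hle : ∀ i ∈ π.parts, i ≤ largestPart π := fun i hi => Multiset.le_sup hi
  refine ⟨?_, fun i hi => hle i hi⟩
  obtain ⟨i₀, hi₀⟩ := exists_mem_parts hn π
  obtain ⟨m, hm, hmax⟩ := Finset.exists_max_image π.parts.toFinset id
    ⟨i₀, Multiset.mem_toFinset.2 hi₀⟩
  have hm' : m ∈ π.parts := Multiset.mem_toFinset.1 hm
  have h1 : largestPart π ≤ m :=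
    Multiset.sup_le.2 fun b hb => hmax b (Multiset.mem_toFinset.2 hb)
  have h2 : largestPart π = m := le_antisymm h1 (hle m hm')
  show largestPart π ∈ π.parts
  rw [h2]
  exact hm'

end PartitionStat

/-!
Both sides of the identity are read off as the `n`-th coefficient of power series in `X` (the
variable usually called `q`), grouped by the largest part.

Partitions with largest part `l` contribute
`T_l(z) = z X^l / (1 - z X^l) * ∏_{i < l} (c - z X^i) / (1 - z X^i)`,
since a part size `i < l` contributes `1 + (1 - 1/c) z X^i / (1 - z X^i)` and the power of `c` can
be spread over the factors (`sum_largestPart_eq`). On the other side the quotient is the geometric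
sum of `(z / c) ^ j`, so that a partition into distinct parts with largest part `M` contributes
`± ∑_{k < s} z^(M - k) c^k`; the partitions with smallest part above `k` then give
`H_M(z) = ∑_{k < M} z^(M - k) c^k X^M ∏_{k < i < M} (1 - X^i)` (`sum_distincts_eq`).

It remains to see that `∑ T_l` and `∑ H_M` agree. Replacing `z` by an arbitrary series `Z`, both
satisfy the functional equation `(1 - Z X) F(Z) = Z X + (c - Z X) F(Z X)`. For partial sums it
holds exactly on the `T` side and up to the term `Z X H_{L + 1}(Z)` on the `H` side, so by induction
on `L` the partial sums up to `L` agree modulo `Z X^(L + 1)`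
(`dvd_sum_largestTerm_sub_sum_distinctTerm`). Working for all `Z` at once is what makes the
induction close: passing from `Z` to `Z X` gains the extra power of `X`.

The generating functions come from Mathlib's `Nat.Partition.hasProd_genFun`; that a given part
occurs is enforced by subtracting the generating function in which this part is forbidden
(`sum_filter_mem_prod`).
-/

open Finset PowerSeries
open scoped PowerSeries.WithPiTopology

namespace PartitionStat

/-! ### The two families of power series and their functional equation -/

/-- The series `T_{l+1}(Z)`: for `Z = C z`, the generating function of the partitions with largest
part `l + 1`, weighted by `z ^ # * c ^ l * (1 - 1 / c) ^ (ν_d - 1)`. The index is shifted so that it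
runs over all natural numbers. -/
noncomputable def largestTerm (c : ℂ) (l : ℕ) (Z : ℂ⟦X⟧) : ℂ⟦X⟧ :=
  Z * X ^ (l + 1) * (1 - Z * X ^ (l + 1))⁻¹ *
    ∏ i ∈ range l, ((C c - Z * X ^ (i + 1)) * (1 - Z * X ^ (i + 1))⁻¹)

/-- The series `H_M(Z)`: for `Z = C z`, the generating function of the partitions into distinct
parts with largest part `M` and smallest part `s`, weighted by
`(-1) ^ (# - 1) * ∑ k < s, z ^ (M - k) * c ^ k`. Here `M` is not shifted. -/
noncomputable def distinctTerm (c : ℂ) (M : ℕ) (Z : ℂ⟦X⟧) : ℂ⟦X⟧ :=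
  ∑ k ∈ range M, Z ^ (M - k) * C c ^ k * (X ^ M * ∏ i ∈ Ico (k + 1) M, (1 - X ^ i))

theorem one_sub_mul_X_pow_mul_inv (Z : ℂ⟦X⟧) {i : ℕ} (hi : i ≠ 0) :
    (1 - Z * X ^ i) * (1 - Z * X ^ i)⁻¹ = 1 :=
  PowerSeries.mul_inv_cancel _ (by simp [hi])

theorem largestTerm_zero (c : ℂ) (Z : ℂ⟦X⟧) :
    (1 - Z * X) * largestTerm c 0 Z = Z * X := by
  have h := one_sub_mul_X_pow_mul_inv Z one_ne_zero
  simp only [largestTerm, range_zero, prod_empty, zero_add, pow_one, mul_one] at h ⊢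
  linear_combination (Z * X) * h

theorem largestTerm_succ (c : ℂ) (l : ℕ) (Z : ℂ⟦X⟧) :
    (1 - Z * X) * largestTerm c (l + 1) Z = (C c - Z * X) * largestTerm c l (Z * X) := by
  have h := one_sub_mul_X_pow_mul_inv Z one_ne_zero
  have e (i : ℕ) : Z * X * X ^ (i + 1) = Z * X ^ (i + 1 + 1) := by ring
  simp only [largestTerm, prod_range_succ', e, zero_add, pow_one] at h ⊢
  linear_combination (Z * X ^ (l + 1 + 1) * (1 - Z * X ^ (l + 1 + 1))⁻¹ *
    (∏ i ∈ range l, ((C c - Z * X ^ (i + 1 + 1)) * (1 - Z * X ^ (i + 1 + 1))⁻¹)) *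
      (C c - Z * X)) * h

theorem distinctTerm_one (c : ℂ) (Z : ℂ⟦X⟧) : distinctTerm c 1 Z = Z * X := by
  simp [distinctTerm]

theorem distinctTerm_succ (c : ℂ) {M : ℕ} (hM : 0 < M) (Z : ℂ⟦X⟧) :
    distinctTerm c (M + 1) Z =
      Z * X * distinctTerm c M Z + (C c - Z * X) * distinctTerm c M (Z * X) := by
  -- The summands for `k < M` on the two sides differ by the increments of `U`. The product in
  -- `U k` starts at `i = k`, so its factor `1 - X ^ 0` makes `U 0` vanish, while `U M` is the
  -- additional summand `k = M` on the left.
  let U (k : ℕ) : ℂ⟦X⟧ :=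
    Z ^ (M + 1 - k) * C c ^ k * X ^ (2 * M + 1 - k) * ∏ i ∈ Ico k M, (1 - X ^ i)
  have hU0 : U 0 = 0 := by
    have : ∏ i ∈ Ico 0 M, (1 - X ^ i : ℂ⟦X⟧) = 0 :=
      prod_eq_zero (i := 0) (by simp [hM]) (by simp)
    simp only [U, this, mul_zero]
  have hUM : U M = Z * C c ^ M * X ^ (M + 1) := by
    simp [U, show 2 * M + 1 - M = M + 1 by omega]
  have tel := sum_range_sub U M
  rw [hU0, hUM, sub_zero] at tel
  have step : ∀ k ∈ range M,
      Z ^ (M + 1 - k) * C c ^ k * (X ^ (M + 1) * ∏ i ∈ Ico (k + 1) (M + 1), (1 - X ^ i)) =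
        Z * X * (Z ^ (M - k) * C c ^ k * (X ^ M * ∏ i ∈ Ico (k + 1) M, (1 - X ^ i))) +
        (C c - Z * X) *
          ((Z * X) ^ (M - k) * C c ^ k * (X ^ M * ∏ i ∈ Ico (k + 1) M, (1 - X ^ i)))
        - (U (k + 1) - U k) := by
    intro k hk
    obtain ⟨d, rfl⟩ := Nat.exists_eq_add_of_lt (mem_range.1 hk)
    simp only [U]
    rw [prod_Ico_succ_top (by omega : k + 1 ≤ k + d + 1),
      prod_eq_prod_Ico_succ_bot (by omega : k < k + d + 1)]
    rw [show k + d + 1 + 1 - k = d + 2 by omega, show k + d + 1 - k = d + 1 by omega,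
      show k + d + 1 + 1 - (k + 1) = d + 1 by omega,
      show 2 * (k + d + 1) + 1 - (k + 1) = k + d + 1 + (d + 1) by omega,
      show 2 * (k + d + 1) + 1 - k = k + d + 1 + (d + 2) by omega]
    ring
  rw [distinctTerm, sum_range_succ, sum_congr rfl step, sum_sub_distrib, tel, sum_add_distrib,
    ← mul_sum, ← mul_sum, ← distinctTerm, ← distinctTerm]
  simp

theorem dvd_distinctTerm (c : ℂ) (M : ℕ) (Z : ℂ⟦X⟧) : X ^ M ∣ distinctTerm c M Z :=
  dvd_sum fun _ _ => Dvd.dvd.mul_left (Dvd.intro _ rfl) _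

/-- The partial sums of the two families agree modulo `Z * X ^ (L + 1)`. The factor `Z` turns into
`Z * X` when the induction hypothesis is used at `Z * X`, which supplies the missing power of `X`. -/
theorem dvd_sum_largestTerm_sub_sum_distinctTerm (c : ℂ) (L : ℕ) (Z : ℂ⟦X⟧) :
    Z * X ^ (L + 1) ∣
      ∑ l ∈ range L, largestTerm c l Z - ∑ l ∈ range L, distinctTerm c (l + 1) Z := by
  induction L generalizing Z with
  | zero => simp
  | succ L ih =>
    have hT : (1 - Z * X) * ∑ l ∈ range (L + 1), largestTerm c l Z =
        Z * X + (C c - Z * X) * ∑ l ∈ range L, largestTerm c l (Z * X) := by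
      rw [sum_range_succ', mul_add, largestTerm_zero, mul_sum, mul_sum,
        sum_congr rfl fun l _ => largestTerm_succ c l Z, add_comm]
    have hH : (1 - Z * X) * ∑ l ∈ range (L + 1), distinctTerm c (l + 1) Z =
        Z * X + (C c - Z * X) * ∑ l ∈ range L, distinctTerm c (l + 1) (Z * X)
          - Z * X * distinctTerm c (L + 1) Z := by
      have h1 : ∑ l ∈ range (L + 1), distinctTerm c (l + 1) Z = Z * X +
          (Z * X * ∑ l ∈ range L, distinctTerm c (l + 1) Z +
            (C c - Z * X) * ∑ l ∈ range L, distinctTerm c (l + 1) (Z * X)) := by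
        rw [sum_range_succ', zero_add, distinctTerm_one,
          sum_congr rfl fun l _ => distinctTerm_succ c (Nat.succ_pos l) Z, sum_add_distrib,
          ← mul_sum, ← mul_sum, add_comm]
      have h2 := sum_range_succ (fun l => distinctTerm c (l + 1) Z) L
      linear_combination h1 - Z * X * h2
    have hu : (1 - Z * X)⁻¹ * (1 - Z * X) = 1 :=
      PowerSeries.inv_mul_cancel _ (by simp)
    obtain ⟨a, ha⟩ := ih (Z * X)
    obtain ⟨b, hb⟩ := dvd_distinctTerm c (L + 1) Z
    refine ⟨(1 - Z * X)⁻¹ * ((C c - Z * X) * a + b), ?_⟩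
    rw [hb] at hH
    linear_combination (1 - Z * X)⁻¹ * hT - (1 - Z * X)⁻¹ * hH
      + (1 - Z * X)⁻¹ * (C c - Z * X) * ha
      - (∑ l ∈ range (L + 1), largestTerm c l Z
          - ∑ l ∈ range (L + 1), distinctTerm c (l + 1) Z) * hu

theorem coeff_sum_largestTerm (z c : ℂ) (n : ℕ) :
    coeff n (∑ l ∈ range n, largestTerm c l (C z)) =
      coeff n (∑ l ∈ range n, distinctTerm c (l + 1) (C z)) := by
  rw [← sub_eq_zero, ← map_sub]
  exact X_pow_dvd_iff.1 ((Dvd.intro_left _ rfl).trans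
    (dvd_sum_largestTerm_sub_sum_distinctTerm c n (C z))) n n.lt_succ_self

/-! ### Generating functions of partitions containing a given part -/

/-- If no part above `L` has a nonzero weight, the product formula for the generating function is a
finite product. -/
theorem genFun_eq_prod_Ico {w : ℕ → ℕ → ℂ} {L : ℕ} {S : ℕ → ℂ⟦X⟧}
    (hw : ∀ i, L < i → ∀ j, w i (j + 1) = 0)
    (hS : ∀ i, 0 < i → i ≤ L → HasSum (fun j => w i (j + 1) • X ^ (i * (j + 1))) (S i)) :
    Nat.Partition.genFun w = ∏ i ∈ Ico 1 (L + 1), (1 + S i) := by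
  rw [prod_Ico_eq_prod_range, Nat.add_sub_cancel]
  refine (Nat.Partition.hasProd_genFun w).unique ?_
  have h : ∏ i ∈ range L, (1 + S (1 + i)) =
      ∏ i ∈ range L, (1 + ∑' j, w (i + 1) (j + 1) • X ^ ((i + 1) * (j + 1)) : ℂ⟦X⟧) :=
    prod_congr rfl fun i hi => by
      rw [add_comm 1 i, (hS (i + 1) i.succ_pos (mem_range.1 hi)).tsum_eq]
  rw [h]
  refine hasProd_prod_of_ne_finset_one fun i hi => ?_
  simp [hw (i + 1) (by simpa [Nat.lt_succ_iff] using hi)]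

/-- Under the same hypotheses, requiring that `L` occurs replaces its factor `1 + S L` by `S L`. -/
theorem sum_filter_mem_prod {w : ℕ → ℕ → ℂ} {L : ℕ} {S : ℕ → ℂ⟦X⟧} (hL : 0 < L)
    (hw : ∀ i, L < i → ∀ j, w i (j + 1) = 0)
    (hS : ∀ i, 0 < i → i ≤ L → HasSum (fun j => w i (j + 1) • X ^ (i * (j + 1))) (S i))
    (n : ℕ) :
    ∑ p : n.Partition with L ∈ p.parts, p.parts.toFinsupp.prod w =
      coeff n (S L * ∏ i ∈ Ico 1 L, (1 + S i)) := by
  -- `w'` forbids the part `L`.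
  let w' (i j : ℕ) : ℂ := if i = L then 0 else w i j
  obtain ⟨m, rfl⟩ := Nat.exists_eq_add_one_of_ne_zero hL.ne'
  have h1 := genFun_eq_prod_Ico hw hS
  have h2 : Nat.Partition.genFun w' = ∏ i ∈ Ico 1 (m + 1), (1 + S i) := by
    refine genFun_eq_prod_Ico (fun i hi j => ?_) (fun i h0 hi => ?_)
    · by_cases h : i = m + 1
      · simp [w', h]
      · simp [w', h, hw i (by omega)]
    · simpa [w', show i ≠ m + 1 by omega] using hS i h0 (by omega)
  have h3 : S (m + 1) * ∏ i ∈ Ico 1 (m + 1), (1 + S i) =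
      Nat.Partition.genFun w - Nat.Partition.genFun w' := by
    rw [h1, h2, prod_Ico_succ_top (Nat.le_add_left 1 m) (fun i => 1 + S i)]
    ring
  rw [h3, map_sub, Nat.Partition.coeff_genFun, Nat.Partition.coeff_genFun, ← sum_sub_distrib,
    sum_filter]
  refine sum_congr rfl fun p _ => ?_
  split_ifs with h
  · have : p.parts.toFinsupp.prod w' = 0 :=
      prod_eq_zero (i := m + 1) (by simpa using h) (by simp [w'])
    rw [this, sub_zero]
  · refine (sub_eq_zero.2 (Finsupp.prod_congr fun i hi => ?_)).symm
    have : i ≠ m + 1 := by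
      rintro rfl
      exact h (by simpa using hi)
    simp [w', this]

/-! ### The sum over all partitions -/

theorem largestPart_eq_iff {n l : ℕ} (hn : n ≠ 0) (p : n.Partition) :
    largestPart p = l ↔ l ∈ p.parts ∧ ∀ i ∈ p.parts, i ≤ l := by
  constructor
  · rintro rfl
    exact ⟨(isGreatest_largestPart hn p).1, fun i hi => (isGreatest_largestPart hn p).2 hi⟩
  · exact fun h => (isGreatest_largestPart hn p).unique ⟨h.1, fun i hi => h.2 i hi⟩

theorem lt_smallestPart_iff {n k : ℕ} (hn : n ≠ 0) (p : n.Partition) :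
    k < smallestPart p ↔ ∀ i ∈ p.parts, k < i :=
  ⟨fun h _ hi => h.trans_le ((isLeast_smallestPart hn p).2 hi),
    fun h => h _ (isLeast_smallestPart hn p).1⟩

theorem prod_toFinset_ite {s : Multiset ℕ} {l : ℕ} (hl : l ∈ s) (a b : ℂ) :
    ∏ i ∈ s.toFinset, (if i = l then a else b) = a * b ^ (s.toFinset.card - 1) := by
  have hl' := Multiset.mem_toFinset.2 hl
  rw [← mul_prod_erase _ _ hl', if_pos rfl,
    prod_congr rfl fun i hi => if_neg (ne_of_mem_erase hi), prod_const, card_erase_of_mem hl']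

theorem sum_largestPart_eq {n : ℕ} (hn : n ≠ 0) (z : ℂ) {c : ℂ} (hc : c ≠ 0) (l : ℕ) :
    ∑ p : n.Partition with largestPart p = l + 1,
        z ^ numParts p * c ^ (largestPart p - 1) * (1 - 1 / c) ^ (numDistinctParts p - 1) =
      coeff n (largestTerm c l (C z)) := by
  let w (i j : ℕ) : ℂ :=
    if l + 1 < i then 0 else z ^ j * (if i = l + 1 then c ^ l else 1 - 1 / c)
  let S (i : ℕ) : ℂ⟦X⟧ :=
    C (if i = l + 1 then c ^ l else 1 - 1 / c) * (C z * X ^ i * (1 - C z * X ^ i)⁻¹)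
  have hS (i : ℕ) (h0 : 0 < i) (hi : i ≤ l + 1) :
      HasSum (fun j => w i (j + 1) • (X : ℂ⟦X⟧) ^ (i * (j + 1))) (S i) := by
    have hcc : constantCoeff (C z * X ^ i : ℂ⟦X⟧) = 0 := by simp [h0.ne']
    have hsum : Summable fun j : ℕ => (C z * X ^ i : ℂ⟦X⟧) ^ j :=
      WithPiTopology.summable_pow_of_constantCoeff_eq_zero hcc
    have hval : ∑' j : ℕ, (C z * X ^ i : ℂ⟦X⟧) ^ j = (1 - C z * X ^ i)⁻¹ := by
      rw [PowerSeries.eq_inv_iff_mul_eq_one (by simp [h0.ne'])]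
      exact WithPiTopology.tsum_pow_mul_one_sub_of_constantCoeff_eq_zero hcc
    have := (hsum.hasSum.mul_left (C z * X ^ i)).mul_left
      (C (if i = l + 1 then c ^ l else 1 - 1 / c))
    rw [hval] at this
    refine this.congr_fun fun j => ?_
    simp only [w, if_neg hi.not_gt, smul_eq_C_mul, map_mul, map_pow]
    ring
  have key := sum_filter_mem_prod (w := w) (S := S) l.succ_pos
    (fun i hi j => by simp only [w, if_pos hi]) hS n
  have hprod : S (l + 1) * ∏ i ∈ Ico 1 (l + 1), (1 + S i) = largestTerm c l (C z) := by
    have h1 : ∀ i ∈ range l, (C c - C z * X ^ (i + 1)) * (1 - C z * X ^ (i + 1))⁻¹ =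
        C c * (1 + S (1 + i)) := by
      intro i hi
      have hi' : 1 + i ≠ l + 1 := by
        have := mem_range.1 hi
        omega
      have hcc : (C c * C (1 - 1 / c) : ℂ⟦X⟧) = C c - 1 := by
        rw [← map_mul, mul_sub, mul_one_div_cancel hc, mul_one, map_sub, map_one]
      have hinv := one_sub_mul_X_pow_mul_inv (C z) (Nat.add_one_ne_zero i)
      simp only [S, if_neg hi']
      rw [add_comm 1 i]
      linear_combination C c * hinv
        - (C z * X ^ (i + 1) * (1 - C z * X ^ (i + 1))⁻¹) * hcc
    rw [largestTerm, prod_congr rfl h1, prod_mul_distrib, prod_const, card_range,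
      prod_Ico_eq_prod_range, Nat.add_sub_cancel]
    simp only [S, if_true, map_pow]
    ring
  rw [← hprod, ← key, sum_filter, sum_filter]
  refine sum_congr rfl fun p _ => ?_
  by_cases hl : l + 1 ∈ p.parts
  swap
  · rw [if_neg hl, if_neg fun h => hl ((largestPart_eq_iff hn p).1 h).1]
  rw [if_pos hl, Finsupp.prod, Multiset.toFinsupp_support]
  by_cases hle : ∀ i ∈ p.parts, i ≤ l + 1
  · have hlp := (largestPart_eq_iff hn p).2 ⟨hl, hle⟩
    rw [if_pos hlp, hlp, Nat.add_sub_cancel]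
    have : ∀ i ∈ p.parts.toFinset, w i (p.parts.toFinsupp i) =
        z ^ p.parts.count i * (if i = l + 1 then c ^ l else 1 - 1 / c) := fun i hi => by
      simp only [w, if_neg (hle i (Multiset.mem_toFinset.1 hi)).not_gt, Multiset.toFinsupp_apply]
    rw [prod_congr rfl this, prod_mul_distrib, prod_pow_eq_pow_sum,
      Multiset.toFinset_sum_count_eq, prod_toFinset_ite hl, numParts, numDistinctParts, mul_assoc]
  · rw [if_neg fun h => hle ((largestPart_eq_iff hn p).1 h).2]
    push Not at hle
    obtain ⟨i, hi, hi'⟩ := hle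
    exact (prod_eq_zero (Multiset.mem_toFinset.2 hi) (by simp only [w, if_pos hi'])).symm

/-! ### The sum over partitions into distinct parts -/

/-- In a partition with distinct parts in `(k, M]` containing `M`, every part but `M` carries the
sign `-1`. -/
theorem sum_distincts_largestPart_eq {n : ℕ} (hn : n ≠ 0) {M k : ℕ} (hk : k < M) :
    ∑ p ∈ Nat.Partition.distincts n with largestPart p = M,
        (if k < smallestPart p then (-1 : ℂ) ^ (numParts p - 1) else 0) =
      coeff n (X ^ M * ∏ i ∈ Ico (k + 1) M, (1 - X ^ i)) := by
  let v (i : ℕ) : ℂ := if M < i ∨ i ≤ k then 0 else if i = M then 1 else -1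
  let w (i j : ℕ) : ℂ := if j = 1 then v i else 0
  let S (i : ℕ) : ℂ⟦X⟧ := C (v i) * X ^ i
  have hS (i : ℕ) (_ : 0 < i) (_ : i ≤ M) :
      HasSum (fun j => w i (j + 1) • (X : ℂ⟦X⟧) ^ (i * (j + 1))) (S i) := by
    have h := hasSum_single (f := fun j => w i (j + 1) • (X : ℂ⟦X⟧) ^ (i * (j + 1))) 0
      fun j hj => by simp [w, hj]
    simpa [w, S, smul_eq_C_mul] using h
  have key := sum_filter_mem_prod (w := w) (S := S) (Nat.zero_lt_of_lt hk)
    (fun i hi j => by simp [w, v, hi]) hS n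
  have hprod : S M * ∏ i ∈ Ico 1 M, (1 + S i) = X ^ M * ∏ i ∈ Ico (k + 1) M, (1 - X ^ i) := by
    have hM : S M = X ^ M := by simp [S, v, hk]
    rw [hM]
    congr 1
    refine (prod_subset_one_on_sdiff (Ico_subset_Ico_left (by omega)) (fun i hi => ?_)
      fun i hi => ?_).symm
    · simp only [mem_sdiff, mem_Ico] at hi
      simp [S, v, show i ≤ k by omega]
    · rw [mem_Ico] at hi
      simp [S, v, show ¬ (M < i ∨ i ≤ k) by omega, show i ≠ M by omega, sub_eq_add_neg]
  rw [← hprod, ← key, sum_filter, sum_filter, Nat.Partition.distincts, sum_filter]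
  refine sum_congr rfl fun p _ => ?_
  rw [Finsupp.prod, Multiset.toFinsupp_support]
  by_cases hM : M ∈ p.parts
  swap
  · simp [hM, largestPart_eq_iff hn]
  rw [if_pos hM]
  by_cases hall : p.parts.Nodup ∧ ∀ i ∈ p.parts, k < i ∧ i ≤ M
  · obtain ⟨hnd, hb⟩ := hall
    rw [if_pos hnd, if_pos ((largestPart_eq_iff hn p).2 ⟨hM, fun i hi => (hb i hi).2⟩),
      if_pos ((lt_smallestPart_iff hn p).2 fun i hi => (hb i hi).1)]
    have : ∀ i ∈ p.parts.toFinset, w i (p.parts.toFinsupp i) = if i = M then 1 else -1 := by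
      intro i hi
      rw [Multiset.mem_toFinset] at hi
      have := hb i hi
      simp [w, v, Multiset.count_eq_one_of_mem hnd hi, show ¬ (M < i ∨ i ≤ k) by omega]
    rw [prod_congr rfl this, prod_toFinset_ite hM, one_mul, numParts,
      Multiset.toFinset_card_of_nodup hnd]
  · have h0 : ∏ i ∈ p.parts.toFinset, w i (p.parts.toFinsupp i) = 0 := by
      by_cases hnd : p.parts.Nodup
      · have : ∃ i ∈ p.parts, M < i ∨ i ≤ k := by
          by_contra! h
          exact hall ⟨hnd, fun i hi => ⟨(h i hi).2, (h i hi).1⟩⟩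
        obtain ⟨i, hi, hi'⟩ := this
        exact prod_eq_zero (Multiset.mem_toFinset.2 hi) (by simp [w, v, hi'])
      · rw [Multiset.nodup_iff_count_le_one] at hnd
        push Not at hnd
        obtain ⟨i, hi⟩ := hnd
        refine prod_eq_zero (i := i) (Multiset.mem_toFinset.2 ?_) (by simp [w, hi.ne'])
        exact Multiset.count_pos.1 (by omega)
    rw [h0]
    split_ifs with h1 h2 h3
    · exact absurd ⟨h1, fun i hi => ⟨(lt_smallestPart_iff hn p).1 h3 i hi,
        ((largestPart_eq_iff hn p).1 h2).2 i hi⟩⟩ hall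
    all_goals rfl

/-! ### Comparison of the two sums -/

theorem largestPart_sub_one_mem_range {n : ℕ} (hn : n ≠ 0) (p : n.Partition) :
    largestPart p - 1 ∈ range n := by
  have h := (isGreatest_largestPart hn p).1
  have h1 := p.parts_pos h
  have h2 := Nat.Partition.le_of_mem_parts h
  rw [mem_range]
  omega

theorem sum_eq_sum_largestPart {n : ℕ} (hn : n ≠ 0) (s : Finset n.Partition)
    (F : n.Partition → ℂ) :
    ∑ p ∈ s, F p = ∑ l ∈ range n, ∑ p ∈ s with largestPart p = l + 1, F p := by
  rw [← sum_fiberwise_of_maps_to fun p _ => largestPart_sub_one_mem_range hn p]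
  refine sum_congr rfl fun l _ => sum_congr (filter_congr fun p _ => ?_) fun _ _ => rfl
  have := p.parts_pos (isGreatest_largestPart hn p).1
  omega

theorem sum_distincts_eq {n : ℕ} (hn : n ≠ 0) (z c : ℂ) :
    ∑ p ∈ Nat.Partition.distincts n, (-1 : ℂ) ^ (numParts p - 1) *
        ∑ k ∈ range (smallestPart p), z ^ (largestPart p - k) * c ^ k =
      coeff n (∑ l ∈ range n, distinctTerm c (l + 1) (C z)) := by
  rw [sum_eq_sum_largestPart hn, map_sum]
  refine sum_congr rfl fun l _ => ?_
  have h : ∀ p ∈ (Nat.Partition.distincts n).filter (largestPart · = l + 1),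
      (-1 : ℂ) ^ (numParts p - 1) *
        ∑ k ∈ range (smallestPart p), z ^ (largestPart p - k) * c ^ k =
      ∑ k ∈ range (l + 1), z ^ (l + 1 - k) * c ^ k *
        (if k < smallestPart p then (-1 : ℂ) ^ (numParts p - 1) else 0) := by
    intro p hp
    have hl := (mem_filter.1 hp).2
    have hs : smallestPart p ≤ l + 1 :=
      hl ▸ (isGreatest_largestPart hn p).2 (isLeast_smallestPart hn p).1
    rw [hl, mul_sum]
    simp only [mul_ite, mul_zero]
    rw [← sum_filter]
    refine sum_congr ?_ fun k _ => mul_comm _ _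
    ext k
    simp only [mem_range, mem_filter]
    omega
  rw [sum_congr rfl h, sum_comm, distinctTerm, map_sum]
  refine sum_congr rfl fun k hk => ?_
  rw [← mul_sum, sum_distincts_largestPart_eq hn (mem_range.1 hk), ← map_pow, ← map_pow,
    ← map_mul, coeff_C_mul]

theorem pow_mul_geom_sum_div (z : ℂ) {c : ℂ} (hc : c ≠ 0) {s l : ℕ} (hs : 0 < s) (hsl : s ≤ l) :
    z ^ (l + 1 - s) * c ^ (s - 1) * ∑ j ∈ range s, (z / c) ^ j =
      ∑ k ∈ range s, z ^ (l - k) * c ^ k := by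
  rw [← sum_range_reflect, mul_sum]
  refine sum_congr rfl fun k hk => ?_
  obtain ⟨d, rfl⟩ := Nat.exists_eq_add_of_lt (mem_range.1 hk)
  obtain ⟨e, rfl⟩ := Nat.exists_eq_add_of_le hsl
  rw [show k + d + 1 + e + 1 - (k + d + 1) = e + 1 by omega,
    show k + d + 1 - 1 = k + d by omega, show k + d - k = d by omega,
    show k + d + 1 + e - k = e + 1 + d by omega]
  have h : c ^ d * (z / c) ^ d = z ^ d := by rw [← mul_pow, mul_div_cancel₀ _ hc]
  linear_combination z ^ (e + 1) * c ^ k * h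

/-- The identity with the quotient written as a geometric sum, valid also for `z = c`. -/
theorem sum_distincts_eq_sum {n : ℕ} (hn : n ≠ 0) (z : ℂ) {c : ℂ} (hc : c ≠ 0) :
    ∑ p ∈ Nat.Partition.distincts n, (-1 : ℂ) ^ (numParts p - 1)
        * z ^ (largestPart p + 1 - smallestPart p) * c ^ (smallestPart p - 1)
        * ∑ j ∈ range (smallestPart p), (z / c) ^ j =
      ∑ p : n.Partition, z ^ numParts p * c ^ (largestPart p - 1)
        * (1 - 1 / c) ^ (numDistinctParts p - 1) := by
  rw [sum_eq_sum_largestPart hn univ, sum_congr rfl fun l _ => sum_largestPart_eq hn z hc l,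
    ← map_sum, coeff_sum_largestTerm, ← sum_distincts_eq hn]
  refine sum_congr rfl fun p _ => ?_
  have hs := isLeast_smallestPart hn p
  rw [← pow_mul_geom_sum_div z hc (p.parts_pos hs.1) ((isGreatest_largestPart hn p).2 hs.1)]
  ring

end PartitionStat

theorem theorem2p3 (n : ℕ) (hn : 1 ≤ n) (z c : ℂ) (hc : c ≠ 0) :
    (z ≠ c →
      ∑ π ∈ Nat.Partition.distincts n,
          (-1 : ℂ) ^ (PartitionStat.numParts π - 1)
            * z ^ (PartitionStat.largestPart π + 1 - PartitionStat.smallestPart π)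
            * c ^ (PartitionStat.smallestPart π - 1)
            * (((z / c) ^ PartitionStat.smallestPart π - 1) / (z / c - 1))
        = ∑ π : n.Partition,
          z ^ PartitionStat.numParts π * c ^ (PartitionStat.largestPart π - 1)
            * (1 - 1 / c) ^ (PartitionStat.numDistinctParts π - 1)) ∧
    -- for `z = c` the quotient is read as its limiting value `s(π)`
    (z = c →
      ∑ π ∈ Nat.Partition.distincts n,
          (-1 : ℂ) ^ (PartitionStat.numParts π - 1)
            * z ^ (PartitionStat.largestPart π + 1 - PartitionStat.smallestPart π)
            * c ^ (PartitionStat.smallestPart π - 1)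
            * (PartitionStat.smallestPart π : ℂ)
        = ∑ π : n.Partition,
          z ^ PartitionStat.numParts π * c ^ (PartitionStat.largestPart π - 1)
            * (1 - 1 / c) ^ (PartitionStat.numDistinctParts π - 1)) := by
  have key := PartitionStat.sum_distincts_eq_sum (Nat.one_le_iff_ne_zero.1 hn) z hc
  refine ⟨fun hzc => ?_, fun hzc => ?_⟩
  · rw [← key]
    refine Finset.sum_congr rfl fun p _ => ?_
    rw [geom_sum_eq (div_ne_one_of_ne hzc)]
  · rw [← key]
    refine Finset.sum_congr rfl fun p _ => ?_
    simp [hzc, div_self hc]
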